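/- **Theorem (Duality).** Let $N\ge 1$ and let $\mathfrak h_1,\dots,\mathfrak h_N$ be complex Hilbert spaces of finite dimensions $d_1,\dots,d_N$, identified with $\mathbb C^{d_1},\dots,\mathbb C^{d_N}$ by a choice of orthonormal bases, and let $\mathfrak h=\mathfrak h_1\otimes\dots\otimes\mathfrak h_N$ with the product basis. Write $\mathcal S(\cdot)$ for the Hermitian operators and $\mathfrak P(\cdot)$ for the density matrices (positive semidefinite, trace one). For operators $A_i$ on $\mathfrak h_i$ put $\bigoplus_{i=1}^N A_i=\sum_{i=1}^N 1\otimes\dots\otimes 1\otimes A_i\otimes 1\otimes\dots\otimes 1$ ($A_i$ in the $i$-th factor). For $\Gamma\in\mathfrak P(\mathfrak h)$ and $\gamma=(\gamma_1,\dots,\gamma_N)$ with $\gamma_i\in\mathfrak P(\mathfrak h_i)$, write $\Gamma\mapsto\gamma$ if $\operatorname{Tr}(\gamma_iA)=\operatorname{Tr}\big(\Gamma\,(1\otimes\dots\otimes 1\otimes A\otimes 1\otimes\dots\otimes 1)\big)$ ($A$ in the $i$-th factor) for every $i$ and every operator $A$ on $\mathfrak h_i$. Let $\varepsilon>0$, let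 $H\in\mathcal S(\mathfrak h)$, let $m=m_1\otimes\dots\otimes m_N$ with each $m_i$ a positive definite operator on $\mathfrak h_i$, and let $\gamma_i\in\mathfrak P(\mathfrak h_i)$ with $\ker\gamma_i=\{0\}$ for every $i$. Put $S(\Gamma|m)=\operatorname{Tr}\big(\Gamma(\log\Gamma-\log m)\big)$ (with $0\log 0=0$), $H_m=H-\varepsilon\log m$, and $$\mathfrak F^\varepsilon_m(\gamma)=\inf\big\{\operatorname{Tr}(H\Gamma)+\varepsilon S(\Gamma|m)\;:\;\Gamma\in\mathfrak P(\mathfrak h),\ \Gamma\mapsto\gamma\big\},$$ $$\mathfrak D^\varepsilon_m(\gamma)=\sup\Big\{\sum_{i=1}^N\operatorname{Tr}(U_i\gamma_i)-\varepsilon\operatorname{Tr}\exp\Big(\frac{\bigoplus_{i=1}^N U_i-H_m}{\varepsilon}\Big)\;:\;U_i\in\mathcal S(\mathfrak h_i)\Big\}+\varepsilon .$$ Then: (i) $\mathfrak F^\varepsilon_m(\gamma)=\mathfrak D^\varepsilon_m(\gamma)$. (ii) The supremum defining $\mathfrak D^\varepsilon_m(\gamma)$ is attained at some $(U_i^\varepsilon)_{i=1}^N$,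 and the maximiser is unique up to trivial translations: if $(U_i^\varepsilon)_i$ and $(\tilde U_i^\varepsilon)_i$ are both maximisers, then there are $\alpha_1,\dots,\alpha_N\in\mathbb R$ with $\sum_{i=1}^N\alpha_i=0$ and $\tilde U_i^\varepsilon-U_i^\varepsilon=\alpha_i 1$ for every $i$. (iii) The infimum defining $\mathfrak F^\varepsilon_m(\gamma)$ is attained at a unique $\Gamma^\varepsilon$, and for every dual maximiser $(U_i^\varepsilon)_i$ $$\Gamma^\varepsilon=\exp\Big(\frac{\bigoplus_{i=1}^N U_i^\varepsilon-H_m}{\varepsilon}\Big).$$ -/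

import Mathlib

open scoped ComplexOrder

noncomputable section

namespace NCOT

open Matrix

/-- Operators on the composite space `𝔥 = ⊗ᵢ 𝔥ᵢ`, where `𝔥ᵢ` is the Hilbert space `ℂ^(n i)`.
The product basis of `𝔥` is indexed by the functions `x` with `x i : n i`. -/
abbrev CompositeOp {ι : Type*} (n : ι → Type*) : Type _ :=
  Matrix ((i : ι) → n i) ((i : ι) → n i) ℂ

section General

variable {ι : Type*} [Fintype ι] [DecidableEq ι]
variable {n : ι → Type*} [∀ i, Fintype (n i)] [∀ i, DecidableEq (n i)]

/-- The tensor product `⊗ᵢ A i` of the operators `A i` on `𝔥ᵢ`. -/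
def tensor (A : (i : ι) → Matrix (n i) (n i) ℂ) : CompositeOp n :=
  fun x y => ∏ i, A i (x i) (y i)

/-- The operator `1 ⊗ ⋯ ⊗ 1 ⊗ A ⊗ 1 ⊗ ⋯ ⊗ 1`, with `A` in the `i`-th factor. -/
def siteOp (i : ι) (A : Matrix (n i) (n i) ℂ) : CompositeOp n :=
  tensor (Function.update (fun _ => 1) i A)

/-- The Kronecker sum `⨁ᵢ U i = ∑ᵢ 1 ⊗ ⋯ ⊗ U i ⊗ ⋯ ⊗ 1`. -/
def kroneckerSum (U : (i : ι) → Matrix (n i) (n i) ℂ) : CompositeOp n :=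
  ∑ i, siteOp i (U i)

end General

section Single

variable {k : Type*} [Fintype k] [DecidableEq k]

/-- Density matrices: positive semidefinite operators of trace one. -/
def IsDensity (A : Matrix k k ℂ) : Prop :=
  A.PosSemidef ∧ A.trace = 1

/-- Logarithm of a Hermitian matrix, by spectral calculus. As `Real.log 0 = 0`, the product
`A * logm A` is `0` on the kernel of `A`, in accordance with the convention `0 log 0 = 0`. -/
def logm (A : Matrix k k ℂ) : Matrix k k ℂ :=
  cfc Real.log A

/-- The relative entropy `S(Γ | m) = Tr (Γ (log Γ - log m))`. -/
def relEntropy (Γ m : Matrix k k ℂ) : ℝ :=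
  (Γ * (logm Γ - logm m)).trace.re

end Single

section Problem

variable {ι : Type*} [Fintype ι] [DecidableEq ι]
variable {n : ι → Type*} [∀ i, Fintype (n i)] [∀ i, DecidableEq (n i)]

/-- `Γ ↦ γ`: the `i`-th marginal (partial trace) of `Γ` is `γ i`, for every `i`. -/
def HasMarginals (Γ : CompositeOp n) (γ : (i : ι) → Matrix (n i) (n i) ℂ) : Prop :=
  ∀ (i : ι) (A : Matrix (n i) (n i) ℂ), (γ i * A).trace = (Γ * siteOp i A).trace

/-- The admissible set of the primal problem. -/
def couplings (γ : (i : ι) → Matrix (n i) (n i) ℂ) : Set (CompositeOp n) :=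
  {Γ | IsDensity Γ ∧ HasMarginals Γ γ}

/-- The primal functional `Tr (H Γ) + ε S(Γ | m)` with `m = ⊗ᵢ m i`. -/
def primalFun (ε : ℝ) (H : CompositeOp n) (m : (i : ι) → Matrix (n i) (n i) ℂ)
    (Γ : CompositeOp n) : ℝ :=
  (H * Γ).trace.re + ε * relEntropy Γ (tensor m)

/-- The primal value `𝔉`. -/
def primalValue (ε : ℝ) (H : CompositeOp n) (m γ : (i : ι) → Matrix (n i) (n i) ℂ) : ℝ :=
  sInf (primalFun ε H m '' couplings γ)

/-- `Γ` is a minimiser of the primal problem. -/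
def IsPrimalMinimiser (ε : ℝ) (H : CompositeOp n) (m γ : (i : ι) → Matrix (n i) (n i) ℂ)
    (Γ : CompositeOp n) : Prop :=
  Γ ∈ couplings γ ∧ IsMinOn (primalFun ε H m) (couplings γ) Γ

/-- The modified Hamiltonian `H_m = H - ε log m` with `m = ⊗ᵢ m i`. -/
def modHamiltonian (ε : ℝ) (H : CompositeOp n) (m : (i : ι) → Matrix (n i) (n i) ℂ) :
    CompositeOp n :=
  H - ε • logm (tensor m)

/-- The operator `exp ((⨁ᵢ U i - H_m) / ε)`. -/
def gibbs (ε : ℝ) (H : CompositeOp n) (m U : (i : ι) → Matrix (n i) (n i) ℂ) : CompositeOp n :=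
  NormedSpace.exp (ε⁻¹ • (kroneckerSum U - modHamiltonian ε H m))

/-- The admissible set of the dual problem: tuples of Hermitian operators. -/
def potentials (n : ι → Type*) : Set ((i : ι) → Matrix (n i) (n i) ℂ) :=
  {U | ∀ i, (U i).IsHermitian}

/-- The dual functional `∑ᵢ Tr (U i γ i) - ε Tr (exp ((⨁ᵢ U i - H_m) / ε))`. -/
def dualFun (ε : ℝ) (H : CompositeOp n) (m γ : (i : ι) → Matrix (n i) (n i) ℂ)
    (U : (i : ι) → Matrix (n i) (n i) ℂ) : ℝ :=
  (∑ i, (U i * γ i).trace.re) - ε * (gibbs ε H m U).trace.re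

/-- The dual value `𝔇`. -/
def dualValue (ε : ℝ) (H : CompositeOp n) (m γ : (i : ι) → Matrix (n i) (n i) ℂ) : ℝ :=
  sSup (dualFun ε H m γ '' potentials n) + ε

/-- `U` is a maximiser of the dual problem. -/
def IsDualMaximiser (ε : ℝ) (H : CompositeOp n) (m γ : (i : ι) → Matrix (n i) (n i) ℂ)
    (U : (i : ι) → Matrix (n i) (n i) ℂ) : Prop :=
  U ∈ potentials n ∧ IsMaxOn (dualFun ε H m γ) (potentials n) U

end Problem

end NCOT

end

set_option linter.unusedSectionVars false

/-! Everything rests on Klein's inequality: for `Γ ≥ 0` and Hermitian `A`, `Tr (Γ A) - Tr (exp A) ≤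
Tr (Γ log Γ) - Tr Γ`, with equality only at `Γ = exp A`. In the eigenbases of `Γ` and `A` it becomes
a scalar inequality averaged over the squared overlaps. With `A = (⨁ U - H_m) / ε`, the duality gap
between a coupling and a tuple `U` is exactly `ε` times the Klein defect (`primalFun_sub_dualFun`).
So weak duality holds, and the gap closes precisely at the Gibbs operator.

It remains to find a dual maximiser whose Gibbs operator is a coupling. First-order optimality
yields the marginals (`gibbs_mem_couplings`). For existence, the linear term of the dual is `Tr (Γ₀
⨁ U)` with `Γ₀ = ⊗ γ i`, which is positive definite because the kernels are trivial; this makes the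
dual coercive in `⨁ U` (`exists_norm_apply_le`).

Two maximisers have the same Gibbs operator; `exp` is injective on Hermitian matrices, and the
kernel of the Kronecker sum consists of the trivial translations. -/

namespace NCOT

open Matrix

/-! ### Matrices in spectral form and overlaps of eigenbases -/

section Spectral

variable {k : Type*} [Fintype k] [DecidableEq k]

/-- The Hermitian matrix with eigenvectors the columns of `U` and eigenvalues `a`. -/
def conjDiag (U : unitaryGroup k ℂ) (a : k → ℝ) : Matrix k k ℂ :=
  (U : Matrix k k ℂ) * diagonal (fun i => (a i : ℂ)) * star (U : Matrix k k ℂ)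

/-- The squared overlaps of the columns of `U` and `V`. -/
def overlap (U V : unitaryGroup k ℂ) (i j : k) : ℝ :=
  Complex.normSq ((star (U : Matrix k k ℂ) * (V : Matrix k k ℂ)) i j)

lemma overlap_nonneg (U V : unitaryGroup k ℂ) (i j : k) : 0 ≤ overlap U V i j :=
  Complex.normSq_nonneg _

lemma sum_normSq_row (W : unitaryGroup k ℂ) (i : k) :
    ∑ j, Complex.normSq ((W : Matrix k k ℂ) i j) = 1 := by
  have h := congrFun (congrFun (mem_unitaryGroup_iff.1 W.2) i) i
  rw [mul_apply, one_apply_eq] at h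
  have h' : ((∑ j, Complex.normSq ((W : Matrix k k ℂ) i j) : ℝ) : ℂ) = 1 := by
    rw [← h, Complex.ofReal_sum]
    exact Finset.sum_congr rfl fun j _ => by
      rw [star_apply, RCLike.star_def, Complex.mul_conj]
  exact_mod_cast h'

/-- With `sum_overlap_left`, the overlaps are doubly stochastic, so a sum over one spectrum can be
written as a weighted sum over pairs of eigenvalues. -/
lemma sum_overlap_right (U V : unitaryGroup k ℂ) (i : k) : ∑ j, overlap U V i j = 1 :=
  sum_normSq_row (star U * V) i

lemma overlap_comm (U V : unitaryGroup k ℂ) (i j : k) : overlap U V i j = overlap V U j i := by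
  have h : star (U : Matrix k k ℂ) * (V : Matrix k k ℂ)
      = star (star (V : Matrix k k ℂ) * (U : Matrix k k ℂ)) := by simp
  rw [overlap, overlap, h, star_apply, RCLike.star_def, Complex.normSq_conj]

lemma sum_overlap_left (U V : unitaryGroup k ℂ) (j : k) : ∑ i, overlap U V i j = 1 := by
  simp_rw [overlap_comm U V]
  exact sum_overlap_right V U j

lemma trace_conjDiag_mul (U V : unitaryGroup k ℂ) (a b : k → ℝ) :
    (conjDiag U a * conjDiag V b).trace = ((∑ i, ∑ j, overlap U V i j * (a i * b j) : ℝ) : ℂ) := by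
  set W : Matrix k k ℂ := star (U : Matrix k k ℂ) * (V : Matrix k k ℂ) with hW
  have h : (conjDiag U a * conjDiag V b).trace
      = (diagonal (fun i => (a i : ℂ)) * W * diagonal (fun i => (b i : ℂ)) * star W).trace := by
    rw [conjDiag, conjDiag, hW, star_mul, star_star, mul_assoc, mul_assoc, trace_mul_comm]
    simp only [mul_assoc]
  rw [h, trace]
  push_cast
  refine Finset.sum_congr rfl fun i _ => ?_
  rw [diag_apply, mul_apply]
  refine Finset.sum_congr rfl fun j _ => ?_
  rw [mul_diagonal, diagonal_mul, star_apply, overlap, ← hW, RCLike.star_def,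
    ← Complex.mul_conj]
  ring

lemma trace_conjDiag (U : unitaryGroup k ℂ) (a : k → ℝ) :
    (conjDiag U a).trace = ((∑ i, a i : ℝ) : ℂ) := by
  rw [conjDiag, trace_mul_cycle, mem_unitaryGroup_iff'.1 U.2, one_mul, trace_diagonal]
  push_cast
  rfl

lemma conjDiag_mul (U : unitaryGroup k ℂ) (a b : k → ℝ) :
    conjDiag U a * conjDiag U b = conjDiag U (fun i => a i * b i) := by
  have h : star (U : Matrix k k ℂ) * (U : Matrix k k ℂ) = 1 := mem_unitaryGroup_iff'.1 U.2
  calc conjDiag U a * conjDiag U b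
      = (U : Matrix k k ℂ) * diagonal (fun i => (a i : ℂ)) * (star (U : Matrix k k ℂ)
        * (U : Matrix k k ℂ)) * diagonal (fun i => (b i : ℂ)) * star (U : Matrix k k ℂ) := by
        simp only [conjDiag, mul_assoc]
    _ = _ := by
        rw [h, mul_one, mul_assoc (U : Matrix k k ℂ), diagonal_mul_diagonal, conjDiag]
        push_cast
        rfl

/-- With `W = U* V`, equality amounts to `diag a * W = W * diag b`, that is, `a i * W i j = W i j *
b j` entrywise. This compares spectral forms without matching eigenvectors. -/
lemma conjDiag_eq_of_overlap {U V : unitaryGroup k ℂ} {a b : k → ℝ}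
    (h : ∀ i j, overlap U V i j ≠ 0 → a i = b j) : conjDiag U a = conjDiag V b := by
  set W : Matrix k k ℂ := star (U : Matrix k k ℂ) * (V : Matrix k k ℂ) with hW
  have hd : diagonal (fun i => (a i : ℂ)) * W = W * diagonal (fun i => (b i : ℂ)) := by
    ext i j
    rw [diagonal_mul, mul_diagonal]
    by_cases hij : W i j = 0
    · rw [hij, mul_zero, zero_mul]
    · rw [h i j (by simpa [overlap, ← hW, Complex.normSq_eq_zero] using hij), mul_comm]
  have hU : (U : Matrix k k ℂ) * star (U : Matrix k k ℂ) = 1 := mem_unitaryGroup_iff.1 U.2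
  have hV : (V : Matrix k k ℂ) * star (V : Matrix k k ℂ) = 1 := mem_unitaryGroup_iff.1 V.2
  calc conjDiag U a
      = (U : Matrix k k ℂ) * (diagonal (fun i => (a i : ℂ)) * W) * star (V : Matrix k k ℂ) := by
        simp only [conjDiag, hW, mul_assoc, hV, mul_one]
    _ = ((U : Matrix k k ℂ) * star (U : Matrix k k ℂ)) * conjDiag V b := by
        rw [hd]; simp only [conjDiag, hW, mul_assoc]
    _ = conjDiag V b := by rw [hU, one_mul]

lemma eq_of_conjDiag_eq {U V : unitaryGroup k ℂ} {a b : k → ℝ}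
    (h : conjDiag U a = conjDiag V b) {i j : k} (hij : overlap U V i j ≠ 0) : a i = b j := by
  set W : Matrix k k ℂ := star (U : Matrix k k ℂ) * (V : Matrix k k ℂ) with hW
  have hU : star (U : Matrix k k ℂ) * (U : Matrix k k ℂ) = 1 := mem_unitaryGroup_iff'.1 U.2
  have hV : star (V : Matrix k k ℂ) * (V : Matrix k k ℂ) = 1 := mem_unitaryGroup_iff'.1 V.2
  have h1 : star (U : Matrix k k ℂ) * conjDiag U a * (V : Matrix k k ℂ)
      = (star (U : Matrix k k ℂ) * (U : Matrix k k ℂ)) * (diagonal (fun i => (a i : ℂ)) * W) := by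
    simp only [conjDiag, hW, mul_assoc]
  have h2 : star (U : Matrix k k ℂ) * conjDiag V b * (V : Matrix k k ℂ)
      = W * diagonal (fun i => (b i : ℂ)) * (star (V : Matrix k k ℂ) * (V : Matrix k k ℂ)) := by
    simp only [conjDiag, hW, mul_assoc]
  rw [hU, one_mul] at h1
  rw [hV, mul_one, ← h, h1] at h2
  have h3 := congrFun (congrFun h2 i) j
  rw [diagonal_mul, mul_diagonal, mul_comm] at h3
  have hne : W i j ≠ 0 := by simpa [overlap, ← hW, Complex.normSq_eq_zero] using hij
  exact_mod_cast mul_left_cancel₀ hne h3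

lemma norm_conjDiag_apply_le (U : unitaryGroup k ℂ) (a : k → ℝ) (x y : k) :
    ‖conjDiag U a x y‖ ≤ ∑ i, |a i| := by
  rw [conjDiag, mul_apply]
  refine (norm_sum_le _ _).trans (Finset.sum_le_sum fun i _ => ?_)
  rw [mul_diagonal, star_apply, norm_mul, norm_mul, norm_star, Complex.norm_real, Real.norm_eq_abs]
  have h1 := entry_norm_bound_of_unitary U.2 x i
  have h2 := entry_norm_bound_of_unitary U.2 y i
  calc _ ≤ 1 * |a i| * 1 := by gcongr
    _ = |a i| := by ring

lemma conjDiag_posSemidef (U : unitaryGroup k ℂ) {a : k → ℝ} (ha : ∀ i, 0 ≤ a i) :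
    (conjDiag U a).PosSemidef := by
  have h : (diagonal (fun i => (a i : ℂ))).PosSemidef :=
    PosSemidef.diagonal fun i => by simpa using ha i
  exact h.mul_mul_conjTranspose_same _

lemma exp_conjDiag (U : unitaryGroup k ℂ) (a : k → ℝ) :
    NormedSpace.exp (conjDiag U a) = conjDiag U (fun i => Real.exp (a i)) := by
  have h : star (U : Matrix k k ℂ) = (U : Matrix k k ℂ)⁻¹ :=
    (inv_eq_left_inv (mem_unitaryGroup_iff'.1 U.2)).symm
  have hU : IsUnit (U : Matrix k k ℂ) := IsUnit.of_mul_eq_one _ (mem_unitaryGroup_iff.1 U.2)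
  rw [conjDiag, conjDiag, h, exp_conj _ _ hU, exp_diagonal]
  congr 3
  ext i
  rw [Pi.coe_exp, ← Complex.exp_eq_exp_ℂ, Complex.ofReal_exp]

end Spectral

/-! ### Logarithm and exponential of Hermitian matrices -/

section Hermitian

variable {k : Type*} [Fintype k] [DecidableEq k] {A B : Matrix k k ℂ}

lemma _root_.Matrix.IsHermitian.eq_conjDiag (hA : A.IsHermitian) :
    A = conjDiag hA.eigenvectorUnitary hA.eigenvalues := by
  conv_lhs => rw [hA.spectral_theorem, Unitary.conjStarAlgAut_apply]
  rfl

lemma _root_.Matrix.IsHermitian.logm_eq (hA : A.IsHermitian) :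
    logm A = conjDiag hA.eigenvectorUnitary (fun i => Real.log (hA.eigenvalues i)) := by
  rw [logm, hA.cfc_eq, IsHermitian.cfc, Unitary.conjStarAlgAut_apply]
  rfl

lemma _root_.Matrix.IsHermitian.exp_eq (hA : A.IsHermitian) :
    NormedSpace.exp A = conjDiag hA.eigenvectorUnitary (fun i => Real.exp (hA.eigenvalues i)) := by
  conv_lhs => rw [hA.eq_conjDiag]
  exact exp_conjDiag _ _

lemma isHermitian_logm (A : Matrix k k ℂ) : (logm A).IsHermitian :=
  (cfc_predicate Real.log A : IsSelfAdjoint _)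

lemma trace_mul_eq_re (hA : A.IsHermitian) (hB : B.IsHermitian) :
    (A * B).trace = ((A * B).trace.re : ℂ) := by
  conv_lhs => rw [hA.eq_conjDiag, hB.eq_conjDiag, trace_conjDiag_mul]
  conv_rhs => rw [hA.eq_conjDiag, hB.eq_conjDiag, trace_conjDiag_mul]
  rw [Complex.ofReal_re]

lemma posSemidef_exp (hA : A.IsHermitian) : (NormedSpace.exp A).PosSemidef := by
  rw [hA.exp_eq]
  exact conjDiag_posSemidef _ fun i => (Real.exp_pos _).le

/-- The spectral theorem may choose different eigenbases for `A` and `exp A`; the overlap criterion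
reduces the claim to `Real.log_exp` on eigenvalues. -/
lemma logm_exp (hA : A.IsHermitian) : logm (NormedSpace.exp A) = A := by
  have h := (posSemidef_exp hA).1
  conv_rhs => rw [hA.eq_conjDiag]
  rw [h.logm_eq]
  refine conjDiag_eq_of_overlap fun i j hij => ?_
  rw [eq_of_conjDiag_eq (h.eq_conjDiag.symm.trans hA.exp_eq) hij, Real.log_exp]

lemma exp_injective_of_isHermitian (hA : A.IsHermitian) (hB : B.IsHermitian)
    (h : NormedSpace.exp A = NormedSpace.exp B) : A = B := by
  rw [← logm_exp hA, h, logm_exp hB]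

end Hermitian

/-! ### Klein's inequality, convexity and coercivity -/

section Klein

variable {k : Type*} [Fintype k] [DecidableEq k] {A B Γ : Matrix k k ℂ}

/-- This is `1 + t ≤ exp t` at `t = c - log x`, multiplied by `x`. At `x = 0` only `exp c` survives.
-/
lemma klein_scalar_nonneg {x : ℝ} (hx : 0 ≤ x) (c : ℝ) :
    0 ≤ x * Real.log x - x - x * c + Real.exp c := by
  rcases hx.eq_or_lt with rfl | hx
  · simpa using (Real.exp_pos c).le
  · have h := Real.add_one_le_exp (c - Real.log x)
    rw [Real.exp_sub, Real.exp_log hx, le_div_iff₀ hx] at h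
    linarith

lemma klein_scalar_eq {x : ℝ} (hx : 0 ≤ x) {c : ℝ}
    (h : x * Real.log x - x - x * c + Real.exp c = 0) : x = Real.exp c := by
  rcases hx.eq_or_lt with rfl | hx
  · simp at h
  · by_contra hne
    have hc : c - Real.log x ≠ 0 := fun h0 => hne (by
      rw [sub_eq_zero.1 h0, Real.exp_log hx])
    have h' := Real.add_one_lt_exp hc
    rw [Real.exp_sub, Real.exp_log hx, lt_div_iff₀ hx] at h'
    linarith

/-- The defect in Klein's inequality. -/
lemma klein_defect_eq (hΓ : Γ.IsHermitian) (hA : A.IsHermitian) :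
    (Γ * logm Γ).trace.re - Γ.trace.re - (Γ * A).trace.re + (NormedSpace.exp A).trace.re =
      ∑ i, ∑ j, overlap hΓ.eigenvectorUnitary hA.eigenvectorUnitary i j *
        (hΓ.eigenvalues i * Real.log (hΓ.eigenvalues i) - hΓ.eigenvalues i
          - hΓ.eigenvalues i * hA.eigenvalues j + Real.exp (hA.eigenvalues j)) := by
  set U := hΓ.eigenvectorUnitary
  set V := hA.eigenvectorUnitary
  have h1 : (Γ * logm Γ).trace.re = ∑ i, ∑ j, overlap U V i j *
      (hΓ.eigenvalues i * Real.log (hΓ.eigenvalues i)) := by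
    conv_lhs => rw [hΓ.logm_eq]
    conv_lhs => enter [1, 1, 1]; rw [hΓ.eq_conjDiag]
    rw [conjDiag_mul, trace_conjDiag, Complex.ofReal_re]
    exact Finset.sum_congr rfl fun i _ => by rw [← Finset.sum_mul, sum_overlap_right, one_mul]
  have h2 : Γ.trace.re = ∑ i, ∑ j, overlap U V i j * hΓ.eigenvalues i := by
    conv_lhs => rw [hΓ.eq_conjDiag, trace_conjDiag, Complex.ofReal_re]
    exact Finset.sum_congr rfl fun i _ => by rw [← Finset.sum_mul, sum_overlap_right, one_mul]
  have h3 : (Γ * A).trace.re = ∑ i, ∑ j, overlap U V i j *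
      (hΓ.eigenvalues i * hA.eigenvalues j) := by
    conv_lhs => rw [hΓ.eq_conjDiag, hA.eq_conjDiag, trace_conjDiag_mul, Complex.ofReal_re]
  have h4 : (NormedSpace.exp A).trace.re = ∑ i, ∑ j, overlap U V i j *
      Real.exp (hA.eigenvalues j) := by
    rw [hA.exp_eq, trace_conjDiag, Complex.ofReal_re, Finset.sum_comm]
    exact Finset.sum_congr rfl fun i _ => by rw [← Finset.sum_mul, sum_overlap_left, one_mul]
  rw [h1, h2, h3, h4]
  simp only [← Finset.sum_sub_distrib, ← Finset.sum_add_distrib]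
  exact Finset.sum_congr rfl fun i _ => Finset.sum_congr rfl fun j _ => by ring

/-- **Klein's inequality.** -/
theorem klein_inequality (hΓ : Γ.PosSemidef) (hA : A.IsHermitian) :
    (Γ * A).trace.re - (NormedSpace.exp A).trace.re ≤
      (Γ * logm Γ).trace.re - Γ.trace.re := by
  have h : 0 ≤ (Γ * logm Γ).trace.re - Γ.trace.re - (Γ * A).trace.re
      + (NormedSpace.exp A).trace.re := by
    rw [klein_defect_eq hΓ.1 hA]
    exact Finset.sum_nonneg fun i _ => Finset.sum_nonneg fun j _ =>
      mul_nonneg (overlap_nonneg _ _ _ _) (klein_scalar_nonneg (hΓ.eigenvalues_nonneg i) _)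
  linarith

/-- The equality case of Klein's inequality. -/
theorem eq_exp_of_klein_eq (hΓ : Γ.PosSemidef) (hA : A.IsHermitian)
    (h : (Γ * A).trace.re - (NormedSpace.exp A).trace.re =
      (Γ * logm Γ).trace.re - Γ.trace.re) : Γ = NormedSpace.exp A := by
  have h0 : (Γ * logm Γ).trace.re - Γ.trace.re - (Γ * A).trace.re
      + (NormedSpace.exp A).trace.re = 0 := by linarith
  have hn : ∀ i j, 0 ≤ overlap hΓ.1.eigenvectorUnitary hA.eigenvectorUnitary i j *
        (hΓ.1.eigenvalues i * Real.log (hΓ.1.eigenvalues i) - hΓ.1.eigenvalues i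
          - hΓ.1.eigenvalues i * hA.eigenvalues j + Real.exp (hA.eigenvalues j)) := fun i j =>
    mul_nonneg (overlap_nonneg _ _ _ _) (klein_scalar_nonneg (hΓ.eigenvalues_nonneg i) _)
  rw [klein_defect_eq hΓ.1 hA,
    Finset.sum_eq_zero_iff_of_nonneg fun i _ => Finset.sum_nonneg fun j _ => hn i j] at h0
  rw [hA.exp_eq]
  conv_lhs => rw [hΓ.1.eq_conjDiag]
  refine conjDiag_eq_of_overlap fun i j hij => ?_
  have h1 := h0 i (Finset.mem_univ i)
  rw [Finset.sum_eq_zero_iff_of_nonneg fun j _ => hn i j] at h1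
  exact klein_scalar_eq (hΓ.eigenvalues_nonneg i)
    ((mul_eq_zero.1 (h1 j (Finset.mem_univ j))).resolve_left hij)

theorem klein_exp (hA : A.IsHermitian) :
    (NormedSpace.exp A * A).trace.re - (NormedSpace.exp A).trace.re =
      (NormedSpace.exp A * logm (NormedSpace.exp A)).trace.re - (NormedSpace.exp A).trace.re := by
  rw [logm_exp hA]

/-- Convexity of `A ↦ Tr (exp A)`, in the form of an upper bound on its increments. -/
theorem trace_exp_sub_le (hA : A.IsHermitian) (hB : B.IsHermitian) :
    (NormedSpace.exp B).trace.re - (NormedSpace.exp A).trace.re ≤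
      (NormedSpace.exp B * (B - A)).trace.re := by
  -- Klein's inequality at `Γ = exp B`, where `log Γ = B`, is the tangent inequality for the convex
  -- trace exponential.
  have h := klein_inequality (posSemidef_exp hB) hA
  rw [logm_exp hB] at h
  rw [mul_sub, trace_sub, Complex.sub_re]
  linarith

/-- For `c ≥ 0` both `p` and `δ` are at most `1`, and `1 + c + c²/2 - 2c > 0`; for `c ≤ 0` the term
`-p * c` suffices. It is applied with `p` an eigenvalue of a density matrix and `δ` a positive lower
bound of its spectrum. -/
lemma mul_abs_le_exp_sub {δ p : ℝ} (hδ : δ ≤ p) (hp : p ≤ 1) (c : ℝ) :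
    δ * |c| ≤ Real.exp c - p * c := by
  rcases le_total 0 c with hc | hc
  · have h := Real.quadratic_le_exp_of_nonneg hc
    rw [abs_of_nonneg hc]
    nlinarith [sq_nonneg (c - 1)]
  · rw [abs_of_nonpos hc]
    nlinarith [Real.exp_pos c]

/-- For a positive definite density matrix `Γ`, the functional `C ↦ Tr (exp C) - Tr (Γ C)` grows at
least linearly. -/
theorem exists_norm_apply_le (hΓ : Γ.PosDef) (ht : Γ.trace = 1) :
    ∃ δ : ℝ, 0 < δ ∧ ∀ C : Matrix k k ℂ, C.IsHermitian → ∀ x y,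
      δ * ‖C x y‖ ≤ (NormedSpace.exp C).trace.re - (Γ * C).trace.re := by
  have hsum : ∑ i, hΓ.1.eigenvalues i = 1 := by
    rw [hΓ.1.eq_conjDiag, trace_conjDiag] at ht
    exact_mod_cast ht
  have hle : ∀ i, hΓ.1.eigenvalues i ≤ 1 := fun i => hsum ▸
    Finset.single_le_sum (fun j _ => (hΓ.eigenvalues_pos j).le) (Finset.mem_univ i)
  obtain ⟨δ, hδ, hδle⟩ : ∃ δ : ℝ, 0 < δ ∧ ∀ i, δ ≤ hΓ.1.eigenvalues i := by
    cases isEmpty_or_nonempty k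
    · exact ⟨1, one_pos, fun i => isEmptyElim i⟩
    · obtain ⟨i, hi⟩ := Finite.exists_min hΓ.1.eigenvalues
      exact ⟨_, hΓ.eigenvalues_pos i, hi⟩
  refine ⟨δ, hδ, fun C hC x y => ?_⟩
  set U := hΓ.1.eigenvectorUnitary
  set V := hC.eigenvectorUnitary
  have h1 : (Γ * C).trace.re = ∑ i, ∑ j, overlap U V i j *
      (hΓ.1.eigenvalues i * hC.eigenvalues j) := by
    conv_lhs => rw [hΓ.1.eq_conjDiag, hC.eq_conjDiag, trace_conjDiag_mul, Complex.ofReal_re]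
  have h2 : (NormedSpace.exp C).trace.re = ∑ i, ∑ j, overlap U V i j *
      Real.exp (hC.eigenvalues j) := by
    rw [hC.exp_eq, trace_conjDiag, Complex.ofReal_re, Finset.sum_comm]
    exact Finset.sum_congr rfl fun i _ => by rw [← Finset.sum_mul, sum_overlap_left, one_mul]
  have h3 : δ * ∑ j, |hC.eigenvalues j| = ∑ i, ∑ j, overlap U V i j *
      (δ * |hC.eigenvalues j|) := by
    rw [Finset.sum_comm, Finset.mul_sum]
    exact Finset.sum_congr rfl fun i _ => by rw [← Finset.sum_mul, sum_overlap_left, one_mul]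
  calc δ * ‖C x y‖ ≤ δ * ∑ j, |hC.eigenvalues j| := by
        conv_lhs => rw [hC.eq_conjDiag]
        exact mul_le_mul_of_nonneg_left (norm_conjDiag_apply_le _ _ _ _) hδ.le
    _ ≤ _ := by
        rw [h1, h2, h3]
        simp only [← Finset.sum_sub_distrib, ← mul_sub]
        exact Finset.sum_le_sum fun i _ => Finset.sum_le_sum fun j _ =>
          mul_le_mul_of_nonneg_left (mul_abs_le_exp_sub (hδle i) (hle i) _) (overlap_nonneg _ _ _ _)

lemma continuous_exp_matrix : Continuous (NormedSpace.exp : Matrix k k ℂ → Matrix k k ℂ) := by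
  let _ : NormedRing (Matrix k k ℂ) := Matrix.linftyOpNormedRing
  let _ : NormedAlgebra ℂ (Matrix k k ℂ) := Matrix.linftyOpNormedAlgebra
  let _ : NormedAlgebra ℚ (Matrix k k ℂ) := NormedAlgebra.restrictScalars ℚ ℂ _
  exact NormedSpace.exp_continuous

end Klein

lemma _root_.Matrix.PosSemidef.exists_eq_conjTranspose_mul_self {k : Type*} [Fintype k]
    [DecidableEq k] {A : Matrix k k ℂ} (hA : A.PosSemidef) : ∃ B, A = Bᴴ * B := by
  have h := conjDiag_posSemidef hA.1.eigenvectorUnitary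
    fun i => Real.sqrt_nonneg (hA.1.eigenvalues i)
  refine ⟨conjDiag hA.1.eigenvectorUnitary fun i => √(hA.1.eigenvalues i), ?_⟩
  rw [h.1.eq, conjDiag_mul]
  simp_rw [Real.mul_self_sqrt (hA.eigenvalues_nonneg _)]
  exact hA.1.eq_conjDiag

/-! ### Tensor products, Kronecker sums and marginals -/

section Tensor

variable {ι : Type*} [Fintype ι] [DecidableEq ι]
variable {n : ι → Type*} [∀ i, Fintype (n i)] [∀ i, DecidableEq (n i)]

lemma tensor_conjTranspose (A : (i : ι) → Matrix (n i) (n i) ℂ) :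
    (tensor A)ᴴ = tensor fun i => (A i)ᴴ := by
  ext x y
  simp [tensor, conjTranspose_apply]

lemma tensor_mul (A B : (i : ι) → Matrix (n i) (n i) ℂ) :
    tensor A * tensor B = tensor fun i => A i * B i := by
  ext x y
  simp only [tensor, mul_apply, ← Finset.prod_mul_distrib]
  rw [Finset.prod_univ_sum, Fintype.piFinset_univ]

lemma trace_tensor (A : (i : ι) → Matrix (n i) (n i) ℂ) :
    (tensor A).trace = ∏ i, (A i).trace := by
  simp only [tensor, trace, diag_apply]
  rw [Finset.prod_univ_sum, Fintype.piFinset_univ]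

lemma tensor_one : tensor (fun i => (1 : Matrix (n i) (n i) ℂ)) = 1 := by
  ext x y
  by_cases h : x = y
  · subst h; simp [tensor]
  · obtain ⟨i, hi⟩ := Function.ne_iff.1 h
    rw [one_apply_ne h]
    exact Finset.prod_eq_zero (Finset.mem_univ i) (one_apply_ne hi)

/-- Writing `A i = (B i)ᴴ * B i` with `B i` invertible gives `tensor A = (tensor B)ᴴ * tensor B`,
and `tensor B` is inverted factorwise. -/
lemma tensor_posDef {A : (i : ι) → Matrix (n i) (n i) ℂ} (hA : ∀ i, (A i).PosDef) :
    (tensor A).PosDef := by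
  choose B hB using fun i => (hA i).posSemidef.exists_eq_conjTranspose_mul_self
  have hu : ∀ i, IsUnit (B i).det := fun i => by
    have h := (isUnit_iff_isUnit_det _).1 (hA i).isUnit
    rw [hB i, det_mul] at h
    exact isUnit_of_mul_isUnit_right h
  have hT : tensor A = (tensor B)ᴴ * tensor B := by
    rw [tensor_conjTranspose, tensor_mul]
    exact congrArg tensor (funext hB)
  have hinv : tensor (fun i => (B i)⁻¹) * tensor B = 1 := by
    rw [tensor_mul, ← tensor_one]
    exact congrArg tensor (funext fun i => nonsing_inv_mul _ (hu i))
  rw [hT]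
  refine PosDef.conjTranspose_mul_self _ fun v w h => ?_
  have h' := congrArg (fun u => tensor (fun i => (B i)⁻¹) *ᵥ u) h
  simpa [mulVec_mulVec, hinv] using h'

lemma siteOp_apply (i : ι) (A : Matrix (n i) (n i) ℂ) (x y : (i : ι) → n i) :
    siteOp i A x y = A (x i) (y i) *
      ∏ j ∈ Finset.univ.erase i, (1 : Matrix (n j) (n j) ℂ) (x j) (y j) := by
  rw [siteOp, tensor, ← Finset.mul_prod_erase _ _ (Finset.mem_univ i), Function.update_self]
  congr 1
  exact Finset.prod_congr rfl fun j hj => by rw [Function.update_of_ne (Finset.ne_of_mem_erase hj)]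

lemma siteOp_add (i : ι) (A B : Matrix (n i) (n i) ℂ) :
    siteOp i (A + B) = siteOp i A + siteOp i B := by
  ext x y
  simp only [Matrix.add_apply, siteOp_apply, add_mul]

lemma siteOp_smul {R : Type*} [SMul R ℂ] [IsScalarTower R ℂ ℂ] (i : ι) (c : R)
    (A : Matrix (n i) (n i) ℂ) : siteOp i (c • A) = c • siteOp i A := by
  ext x y
  simp only [Matrix.smul_apply, siteOp_apply, smul_mul_assoc]

lemma siteOp_one (i : ι) : siteOp i (1 : Matrix (n i) (n i) ℂ) = 1 := by
  rw [siteOp, ← tensor_one]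
  congr 1
  exact Function.update_eq_self i (fun i => (1 : Matrix (n i) (n i) ℂ))

lemma siteOp_isHermitian {i : ι} {A : Matrix (n i) (n i) ℂ} (hA : A.IsHermitian) :
    (siteOp i A).IsHermitian := by
  rw [IsHermitian, siteOp, tensor_conjTranspose]
  congr 1
  ext j : 1
  by_cases h : j = i
  · subst h; simpa using hA.eq
  · simp [Function.update_of_ne h]

lemma siteOp_zero (i : ι) : siteOp i (0 : Matrix (n i) (n i) ℂ) = 0 := by
  ext x y
  simp [siteOp_apply]

lemma trace_tensor_mul_siteOp {γ : (i : ι) → Matrix (n i) (n i) ℂ} (hγ : ∀ i, (γ i).trace = 1)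
    (i : ι) (A : Matrix (n i) (n i) ℂ) :
    (tensor γ * siteOp i A).trace = (γ i * A).trace := by
  rw [siteOp, tensor_mul, trace_tensor, ← Finset.mul_prod_erase _ _ (Finset.mem_univ i),
    Function.update_self, Finset.prod_eq_one, mul_one]
  intro j hj
  rw [Function.update_of_ne (Finset.ne_of_mem_erase hj), mul_one, hγ]

/-- The Kronecker sum, as a real-linear map. -/
def kroneckerSumLin (n : ι → Type*) [∀ i, Fintype (n i)] [∀ i, DecidableEq (n i)] :
    ((i : ι) → Matrix (n i) (n i) ℂ) →ₗ[ℝ] CompositeOp n where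
  toFun := kroneckerSum
  map_add' U V := by simp [kroneckerSum, siteOp_add, Finset.sum_add_distrib]
  map_smul' c U := by simp [kroneckerSum, siteOp_smul, Finset.smul_sum]

lemma kroneckerSum_isHermitian {U : (i : ι) → Matrix (n i) (n i) ℂ} (hU : U ∈ potentials n) :
    (kroneckerSum U).IsHermitian := by
  rw [IsHermitian, kroneckerSum, conjTranspose_sum]
  exact Finset.sum_congr rfl fun i _ => siteOp_isHermitian (hU i)

lemma kroneckerSum_single (i : ι) (A : Matrix (n i) (n i) ℂ) :
    kroneckerSum (Pi.single i A) = siteOp i A := by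
  rw [kroneckerSum, Finset.sum_eq_single i, Pi.single_eq_same]
  · intro j _ hj
    rw [Pi.single_eq_of_ne hj, siteOp_zero]
  · simp

lemma kroneckerSum_apply_self (U : (i : ι) → Matrix (n i) (n i) ℂ) (x : (i : ι) → n i) :
    kroneckerSum U x x = ∑ i, U i (x i) (x i) := by
  simp [kroneckerSum, Matrix.sum_apply, siteOp_apply]

/-- Every summand at a site other than `i` contains the entry `1 a b = 0`, so off-diagonal entries
of `U i` can be read off the sum. -/
lemma kroneckerSum_apply_update (U : (i : ι) → Matrix (n i) (n i) ℂ) (x : (i : ι) → n i) (i : ι)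
    {a b : n i} (hab : a ≠ b) :
    kroneckerSum U (Function.update x i a) (Function.update x i b) = U i a b := by
  rw [kroneckerSum, Matrix.sum_apply, Finset.sum_eq_single i]
  · rw [siteOp_apply, Function.update_self, Function.update_self, Finset.prod_eq_one, mul_one]
    intro j hj
    rw [Function.update_of_ne (Finset.ne_of_mem_erase hj),
      Function.update_of_ne (Finset.ne_of_mem_erase hj), one_apply_eq]
  · intro j _ hj
    rw [siteOp_apply]
    refine mul_eq_zero_of_right _
      (Finset.prod_eq_zero (Finset.mem_erase.2 ⟨hj.symm, Finset.mem_univ i⟩) ?_)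
    rw [Function.update_self, Function.update_self, one_apply_ne hab]
  · simp

/-- The kernel of the Kronecker sum on Hermitian tuples consists of the trivial translations. -/
theorem exists_smul_one_of_kroneckerSum_eq_zero [∀ i, Nonempty (n i)]
    {U : (i : ι) → Matrix (n i) (n i) ℂ} (hU : U ∈ potentials n) (h : kroneckerSum U = 0) :
    ∃ α : ι → ℝ, ∑ i, α i = 0 ∧ ∀ i, U i = α i • (1 : Matrix (n i) (n i) ℂ) := by
  let z : (i : ι) → n i := fun i => Classical.arbitrary (n i)
  have hdiag : ∀ x : (i : ι) → n i, ∑ i, U i (x i) (x i) = 0 := fun x => by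
    rw [← kroneckerSum_apply_self, h, Matrix.zero_apply]
  have hre : ∀ i a, ((U i a a).re : ℂ) = U i a a := fun i a => (hU i).coe_re_apply_self a
  refine ⟨fun i => (U i (z i) (z i)).re, ?_, fun i => ?_⟩
  · have h0 := hdiag z
    rw [Finset.sum_congr rfl fun i _ => (hre i (z i)).symm] at h0
    exact_mod_cast h0
  · ext a b
    rw [Matrix.smul_apply]
    by_cases hab : a = b
    · subst hab
      rw [one_apply_eq, Complex.real_smul, mul_one, hre]
      -- Moving only the `i`-th coordinate of `z` changes a single summand, so the diagonal of `U i`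
      -- is constant.
      have h1 := hdiag (Function.update z i a)
      have h2 := hdiag z
      rw [← Finset.add_sum_erase _ _ (Finset.mem_univ i)] at h1 h2
      rw [Function.update_self, Finset.sum_congr rfl fun j hj => by
        rw [Function.update_of_ne (Finset.ne_of_mem_erase hj)]] at h1
      exact add_right_cancel (h1.trans h2.symm)
    · rw [one_apply_ne hab, smul_zero, ← kroneckerSum_apply_update U z i hab, h, Matrix.zero_apply]

lemma trace_mul_kroneckerSum {Γ : CompositeOp n} {γ : (i : ι) → Matrix (n i) (n i) ℂ}
    (h : HasMarginals Γ γ) (U : (i : ι) → Matrix (n i) (n i) ℂ) :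
    (Γ * kroneckerSum U).trace.re = ∑ i, (U i * γ i).trace.re := by
  rw [kroneckerSum, Finset.mul_sum, trace_sum, Complex.re_sum]
  exact Finset.sum_congr rfl fun i _ => by rw [← h, trace_mul_comm]

lemma hasMarginals_tensor {γ : (i : ι) → Matrix (n i) (n i) ℂ} (hγ : ∀ i, (γ i).trace = 1) :
    HasMarginals (tensor γ) γ :=
  fun i A => (trace_tensor_mul_siteOp hγ i A).symm

end Tensor

lemma posDef_of_ker_eq_bot {k : Type*} [Fintype k] [DecidableEq k] {A : Matrix k k ℂ}
    (hA : A.PosSemidef) (hker : LinearMap.ker A.mulVecLin = ⊥) : A.PosDef := by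
  refine hA.posDef_iff_isUnit.2 (mulVec_injective_iff_isUnit.1 ?_)
  exact LinearMap.ker_eq_bot.1 hker

/-! ### Duality gap, optimality and existence of maximisers -/

section Duality

variable {ι : Type*} [Fintype ι] [DecidableEq ι]
variable {n : ι → Type*} [∀ i, Fintype (n i)] [∀ i, DecidableEq (n i)]
variable {ε : ℝ} {H : CompositeOp n} {m γ U V : (i : ι) → Matrix (n i) (n i) ℂ} {Γ : CompositeOp n}

lemma gibbs_exponent_isHermitian (hH : H.IsHermitian) (hU : U ∈ potentials n) :
    (ε⁻¹ • (kroneckerSum U - modHamiltonian ε H m)).IsHermitian := by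
  have hr : ∀ (c : ℝ) {A : CompositeOp n}, A.IsHermitian → (c • A).IsHermitian :=
    fun c A hA => (IsSelfAdjoint.all c).smul hA
  exact hr _ ((kroneckerSum_isHermitian hU).sub (hH.sub (hr _ (isHermitian_logm _))))

lemma primalFun_eq (ε : ℝ) (H : CompositeOp n) (m : (i : ι) → Matrix (n i) (n i) ℂ)
    (Γ : CompositeOp n) :
    primalFun ε H m Γ = (Γ * modHamiltonian ε H m).trace.re + ε * (Γ * logm Γ).trace.re := by
  simp only [primalFun, relEntropy, modHamiltonian, mul_sub, trace_sub, Complex.sub_re,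
    Matrix.mul_smul, trace_smul, Complex.smul_re, smul_eq_mul, trace_mul_comm H]
  ring

lemma trace_mul_gibbs_exponent (hε : 0 < ε) (Γ B : CompositeOp n) :
    ε * (Γ * (ε⁻¹ • (B - modHamiltonian ε H m))).trace.re =
      (Γ * B).trace.re - (Γ * modHamiltonian ε H m).trace.re := by
  rw [Matrix.mul_smul, trace_smul, Complex.smul_re, smul_eq_mul, ← mul_assoc, mul_inv_cancel₀ hε.ne',
    one_mul, mul_sub, trace_sub, Complex.sub_re]

/-- The marginal condition turns `∑ i, Tr (U i γ i)` into `Tr (Γ ⨁ U)`, and the constant `ε` is `ε *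
Tr Γ`. -/
lemma primalFun_sub_dualFun (hε : 0 < ε) (hΓ : Γ ∈ couplings γ) :
    primalFun ε H m Γ - (dualFun ε H m γ U + ε) =
      ε * (((Γ * logm Γ).trace.re - Γ.trace.re) -
        ((Γ * (ε⁻¹ • (kroneckerSum U - modHamiltonian ε H m))).trace.re
          - (gibbs ε H m U).trace.re)) := by
  rw [primalFun_eq, dualFun, ← trace_mul_kroneckerSum hΓ.2 U, hΓ.1.2, Complex.one_re]
  linear_combination (trace_mul_gibbs_exponent (H := H) (m := m) hε Γ (kroneckerSum U))

theorem weak_duality (hε : 0 < ε) (hH : H.IsHermitian) (hΓ : Γ ∈ couplings γ)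
    (hU : U ∈ potentials n) : dualFun ε H m γ U + ε ≤ primalFun ε H m Γ := by
  have h := klein_inequality hΓ.1.1 (gibbs_exponent_isHermitian (ε := ε) (m := m) hH hU)
  rw [← sub_nonneg, primalFun_sub_dualFun hε hΓ]
  exact mul_nonneg hε.le (sub_nonneg.2 h)

theorem eq_gibbs_of_primalFun_eq (hε : 0 < ε) (hH : H.IsHermitian) (hΓ : Γ ∈ couplings γ)
    (hU : U ∈ potentials n) (h : primalFun ε H m Γ = dualFun ε H m γ U + ε) :
    Γ = gibbs ε H m U := by
  rw [← sub_eq_zero, primalFun_sub_dualFun hε hΓ] at h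
  exact eq_exp_of_klein_eq hΓ.1.1 (gibbs_exponent_isHermitian hH hU)
    (sub_eq_zero.1 ((mul_eq_zero.1 h).resolve_left hε.ne')).symm

theorem primalFun_gibbs (hε : 0 < ε) (hH : H.IsHermitian) (hU : U ∈ potentials n)
    (h : gibbs ε H m U ∈ couplings γ) :
    primalFun ε H m (gibbs ε H m U) = dualFun ε H m γ U + ε := by
  rw [← sub_eq_zero, primalFun_sub_dualFun (U := U) hε h, gibbs,
    klein_exp (gibbs_exponent_isHermitian hH hU), sub_self, mul_zero]

lemma potentials_add_smul (hU : U ∈ potentials n) (hV : V ∈ potentials n) (t : ℝ) :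
    U + t • V ∈ potentials n :=
  fun i => (hU i).add ((IsSelfAdjoint.all t).smul (hV i) : IsSelfAdjoint (t • V i))

/-- The exponential need not be differentiated: maximality against `U + t • V` and the convexity
bound give the inequality at the perturbed Gibbs operator for each `t > 0`, and continuity lets `t →
0`. -/
lemma trace_le_of_isDualMaximiser (hε : 0 < ε) (hH : H.IsHermitian)
    (hU : IsDualMaximiser ε H m γ U) (hV : V ∈ potentials n) :
    ∑ i, (V i * γ i).trace.re ≤ (gibbs ε H m U * kroneckerSum V).trace.re := by
  have hexp : ∀ t : ℝ, ε⁻¹ • (kroneckerSum (U + t • V) - modHamiltonian ε H m) =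
      ε⁻¹ • (kroneckerSum U - modHamiltonian ε H m) + (ε⁻¹ * t) • kroneckerSum V := fun t => by
    have h : kroneckerSum (U + t • V) = kroneckerSum U + t • kroneckerSum V :=
      ((kroneckerSumLin n).map_add U (t • V)).trans
        (congrArg _ ((kroneckerSumLin n).map_smul t V))
    rw [h, add_sub_right_comm, smul_add, smul_smul]
  have hle : ∀ t : ℝ, 0 < t →
      ∑ i, (V i * γ i).trace.re ≤ (gibbs ε H m (U + t • V) * kroneckerSum V).trace.re := by
    intro t ht
    have hUt := potentials_add_smul hU.1 hV t
    have h1 : dualFun ε H m γ (U + t • V) ≤ dualFun ε H m γ U := hU.2 hUt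
    have h2 := trace_exp_sub_le (gibbs_exponent_isHermitian (ε := ε) (m := m) hH hU.1)
      (gibbs_exponent_isHermitian (ε := ε) (m := m) hH hUt)
    rw [← gibbs, ← gibbs, hexp, add_sub_cancel_left, Matrix.mul_smul, trace_smul, Complex.smul_re,
      smul_eq_mul] at h2
    have h3 : ∑ i, ((U + t • V) i * γ i).trace.re =
        ∑ i, (U i * γ i).trace.re + t * ∑ i, (V i * γ i).trace.re := by
      rw [Finset.mul_sum, ← Finset.sum_add_distrib]
      exact Finset.sum_congr rfl fun i _ => by
        simp [add_mul, trace_smul]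
    rw [dualFun, dualFun, h3] at h1
    have h4 := mul_le_mul_of_nonneg_left h2 hε.le
    rw [← mul_assoc, ← mul_assoc, mul_inv_cancel₀ hε.ne', one_mul] at h4
    exact le_of_mul_le_mul_left (by linarith) ht
  have hc : Continuous fun t : ℝ => (gibbs ε H m (U + t • V) * kroneckerSum V).trace.re := by
    simp only [gibbs, hexp]
    refine Complex.continuous_re.comp (Continuous.matrix_trace (Continuous.mul
      (continuous_exp_matrix.comp ?_) continuous_const))
    fun_prop
  have ht : Filter.Tendsto (fun t : ℝ => (gibbs ε H m (U + t • V) * kroneckerSum V).trace.re)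
      (nhdsWithin 0 (Set.Ioi 0)) (nhds (gibbs ε H m U * kroneckerSum V).trace.re) := by
    have h := (hc.tendsto 0).mono_left (nhdsWithin_le_nhds (s := Set.Ioi 0))
    simpa only [zero_smul, add_zero] using h
  exact ge_of_tendsto ht (Filter.eventually_of_mem self_mem_nhdsWithin fun t ht => hle t ht)

lemma trace_eq_of_isDualMaximiser (hε : 0 < ε) (hH : H.IsHermitian)
    (hU : IsDualMaximiser ε H m γ U) (hV : V ∈ potentials n) :
    ∑ i, (V i * γ i).trace.re = (gibbs ε H m U * kroneckerSum V).trace.re := by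
  refine le_antisymm (trace_le_of_isDualMaximiser hε hH hU hV) ?_
  have h := trace_le_of_isDualMaximiser hε hH hU (V := -V) fun i => (hV i).neg
  have hn : kroneckerSum (-V) = -kroneckerSum V := (kroneckerSumLin n).map_neg V
  simpa [hn, Finset.sum_neg_distrib] using h

/-- First-order optimality: the Gibbs state of a dual maximiser is a coupling. -/
theorem gibbs_mem_couplings [Nonempty ι] (hε : 0 < ε) (hH : H.IsHermitian)
    (hγ : ∀ i, IsDensity (γ i)) (hU : IsDualMaximiser ε H m γ U) :
    gibbs ε H m U ∈ couplings γ := by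
  have hpos : (gibbs ε H m U).PosSemidef := posSemidef_exp (gibbs_exponent_isHermitian hH hU.1)
  have hherm : ∀ (i : ι) (A : Matrix (n i) (n i) ℂ), A.IsHermitian →
      (γ i * A).trace = (gibbs ε H m U * siteOp i A).trace := by
    intro i A hA
    have hs : Pi.single i A ∈ potentials n := fun j => by
      by_cases h : j = i
      · subst h; rwa [Pi.single_eq_same]
      · rw [Pi.single_eq_of_ne h]; exact isHermitian_zero
    have h := trace_eq_of_isDualMaximiser hε hH hU hs
    rw [kroneckerSum_single, Finset.sum_eq_single i, Pi.single_eq_same, trace_mul_comm] at h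
    · rw [trace_mul_eq_re (hγ i).1.1 hA, trace_mul_eq_re hpos.1 (siteOp_isHermitian hA), h]
    · intro j _ hj
      simp [Pi.single_eq_of_ne hj]
    · simp
  have hmarg : HasMarginals (gibbs ε H m U) γ := by
    intro i A
    -- Optimality tests only Hermitian `A`; complex linearity extends the identity to all operators.
    have hA : A = (realPart A : Matrix (n i) (n i) ℂ)
        + Complex.I • (imaginaryPart A : Matrix (n i) (n i) ℂ) :=
      (realPart_add_I_smul_imaginaryPart A).symm
    rw [hA, siteOp_add, siteOp_smul, mul_add, mul_add, Matrix.mul_smul, Matrix.mul_smul, trace_add, trace_add,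
      trace_smul, trace_smul, hherm i _ (realPart A).2, hherm i _ (imaginaryPart A).2]
  refine ⟨⟨hpos, ?_⟩, hmarg⟩
  obtain ⟨i⟩ := ‹Nonempty ι›
  have h := hmarg i 1
  rwa [siteOp_one, mul_one, mul_one, (hγ i).2, eq_comm] at h

/-- The dual problem has a maximiser. -/
theorem exists_isDualMaximiser (hε : 0 < ε) (hH : H.IsHermitian) (hγ : ∀ i, (γ i).PosDef)
    (htr : ∀ i, (γ i).trace = 1) : ∃ U, IsDualMaximiser ε H m γ U := by
  set Γ₀ := tensor γ
  have hΓ₀ : Γ₀.PosDef := tensor_posDef hγ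
  have hΓ₀tr : Γ₀.trace = 1 := by rw [trace_tensor, Finset.prod_eq_one fun i _ => htr i]
  -- The dual functional is invariant under trivial translations, hence not coercive in `U`; it is
  -- maximised as a function of `B = ⨁ U` on the subspace `L` instead.
  let g : CompositeOp n → ℝ := fun B => (Γ₀ * B).trace.re
    - ε * (NormedSpace.exp (ε⁻¹ • (B - modHamiltonian ε H m))).trace.re
  have hg : ∀ W, dualFun ε H m γ W = g (kroneckerSum W) := fun W => by
    rw [dualFun, ← trace_mul_kroneckerSum (hasMarginals_tensor htr)]
    rfl
  have hgc : Continuous g := by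
    refine Continuous.sub ?_ (continuous_const.mul (Complex.continuous_re.comp
      (Continuous.matrix_trace (continuous_exp_matrix.comp ?_)))) <;> fun_prop
  let P : Submodule ℝ ((i : ι) → Matrix (n i) (n i) ℂ) :=
    Submodule.pi Set.univ fun i => selfAdjoint.submodule ℝ (Matrix (n i) (n i) ℂ)
  have hP : ∀ W, W ∈ P ↔ W ∈ potentials n := fun W => by
    simp only [P, Submodule.mem_pi, Set.mem_univ, true_imp_iff]
    rfl
  let L : Submodule ℝ (CompositeOp n) := P.map (kroneckerSumLin n)
  have hL : IsClosed (L : Set (CompositeOp n)) := L.closed_of_finiteDimensional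
  obtain ⟨δ, hδ, hbound⟩ := exists_norm_apply_le hΓ₀ hΓ₀tr
  set c : ℝ := (Γ₀ * modHamiltonian ε H m).trace.re
  -- The exponents of the points of `L` where `g` is at least `g 0` lie in a ball.
  set R : ℝ := (c - g 0) / (ε * δ)
  let T : CompositeOp n → CompositeOp n := fun B => ε⁻¹ • (B - modHamiltonian ε H m)
  let D : Set (CompositeOp n) := Set.univ.pi fun _ => Set.univ.pi fun _ => Metric.closedBall 0 R
  have hD : IsCompact D :=
    isCompact_univ_pi fun _ => isCompact_univ_pi fun _ => isCompact_closedBall _ _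
  let T' : CompositeOp n → CompositeOp n := fun C => ε • C + modHamiltonian ε H m
  have hT' : Continuous T' := by fun_prop
  have hTT : ∀ B, T' (T B) = B := fun B => by
    simp only [T, T', smul_smul, mul_inv_cancel₀ hε.ne', one_smul, sub_add_cancel]
  have hmem : ∀ B ∈ L, g 0 ≤ g B → B ∈ T' '' D := by
    rintro B ⟨W, hW, rfl⟩ hB
    refine ⟨T (kroneckerSum W), ?_, hTT _⟩
    intro x _ y _
    rw [mem_closedBall_zero_iff, le_div_iff₀ (by positivity)]
    have h1 := hbound _ (gibbs_exponent_isHermitian (ε := ε) (m := m) hH ((hP W).1 hW)) x y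
    have h2 := trace_mul_gibbs_exponent (H := H) (m := m) hε Γ₀ (kroneckerSum W)
    have h3 := mul_le_mul_of_nonneg_left h1 hε.le
    rw [mul_sub, h2] at h3
    have h4 : g (kroneckerSum W) = (Γ₀ * kroneckerSum W).trace.re
      - ε * (NormedSpace.exp (ε⁻¹ • (kroneckerSum W - modHamiltonian ε H m))).trace.re := rfl
    change g 0 ≤ g (kroneckerSum W) at hB
    -- The linear growth bound reads `ε * δ * ‖T B x y‖ ≤ c - g B`, and `g 0 ≤ g B` accounts for the
    -- choice of `R`.
    calc _ = ε * (δ * ‖T (kroneckerSum W) x y‖) := by ring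
      _ ≤ _ := h3
      _ ≤ _ := by linarith
  have hK : IsCompact ((L : Set (CompositeOp n)) ∩ T' '' D) := (hD.image hT').inter_left hL
  have h0 : (0 : CompositeOp n) ∈ (L : Set (CompositeOp n)) ∩ T' '' D :=
    ⟨L.zero_mem, hmem 0 L.zero_mem le_rfl⟩
  obtain ⟨B, ⟨⟨U, hU, rfl⟩, -⟩, hmax⟩ := hK.exists_isMaxOn ⟨0, h0⟩ hgc.continuousOn
  refine ⟨U, (hP U).1 hU, fun W hW => ?_⟩
  change dualFun ε H m γ W ≤ dualFun ε H m γ U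
  rw [hg, hg]
  have hWL : kroneckerSum W ∈ L := ⟨W, (hP W).2 hW, rfl⟩
  rcases le_total (g 0) (g (kroneckerSum W)) with h | h
  · exact hmax ⟨hWL, hmem _ hWL h⟩
  · exact h.trans (hmax h0)

end Duality

end NCOT

/-! ### Assembly of the duality theorem -/

theorem mainTheorem1 (N : ℕ) (hN : 1 ≤ N) (d : Fin N → ℕ) (ε : ℝ) (hε : 0 < ε)
    (H : NCOT.CompositeOp (fun i => Fin (d i))) (hH : H.IsHermitian)
    (m : (i : Fin N) → Matrix (Fin (d i)) (Fin (d i)) ℂ) (hm : ∀ i, (m i).PosDef)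
    (γ : (i : Fin N) → Matrix (Fin (d i)) (Fin (d i)) ℂ) (hγ : ∀ i, NCOT.IsDensity (γ i))
    (hker : ∀ i, LinearMap.ker (γ i).mulVecLin = ⊥) :
    -- (i) the primal and dual values coincide
    NCOT.primalValue ε H m γ = NCOT.dualValue ε H m γ ∧
    -- (ii) a dual maximiser exists and is unique up to trivial translations
    (∃ U, NCOT.IsDualMaximiser ε H m γ U) ∧
    (∀ U U', NCOT.IsDualMaximiser ε H m γ U → NCOT.IsDualMaximiser ε H m γ U' →
      ∃ α : Fin N → ℝ, ∑ i, α i = 0 ∧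
        ∀ i, U' i - U i = α i • (1 : Matrix (Fin (d i)) (Fin (d i)) ℂ)) ∧
    -- (iii) the primal minimiser exists, is unique, and has the stated exponential form
    (∃! Γ, NCOT.IsPrimalMinimiser ε H m γ Γ) ∧
    (∀ U Γ, NCOT.IsDualMaximiser ε H m γ U → NCOT.IsPrimalMinimiser ε H m γ Γ →
      Γ = NormedSpace.exp
        (ε⁻¹ • (NCOT.kroneckerSum U - NCOT.modHamiltonian ε H m))) := by
  have : Nonempty (Fin N) := ⟨⟨0, hN⟩⟩
  -- A matrix of size zero has trace `0`, so it is not a density matrix.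
  have hne : ∀ i, Nonempty (Fin (d i)) := fun i => by
    by_contra h
    have := not_nonempty_iff.1 h
    simpa [Matrix.trace] using (hγ i).2
  obtain ⟨U₀, hU₀⟩ := NCOT.exists_isDualMaximiser (m := m) hε hH
    (fun i => NCOT.posDef_of_ker_eq_bot (hγ i).1 (hker i)) fun i => (hγ i).2
  have hmin : ∀ {U}, NCOT.IsDualMaximiser ε H m γ U →
      NCOT.IsPrimalMinimiser ε H m γ (NCOT.gibbs ε H m U) := fun {U} hU =>
    ⟨NCOT.gibbs_mem_couplings hε hH hγ hU, fun Γ hΓ => by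
      change NCOT.primalFun ε H m (NCOT.gibbs ε H m U) ≤ NCOT.primalFun ε H m Γ
      rw [NCOT.primalFun_gibbs hε hH hU.1 (NCOT.gibbs_mem_couplings hε hH hγ hU)]
      exact NCOT.weak_duality hε hH hΓ hU.1⟩
  have hgibbs : ∀ {U Γ}, NCOT.IsDualMaximiser ε H m γ U → NCOT.IsPrimalMinimiser ε H m γ Γ →
      Γ = NCOT.gibbs ε H m U := fun {U Γ} hU hΓ => by
    refine NCOT.eq_gibbs_of_primalFun_eq hε hH hΓ.1 hU.1 (le_antisymm ?_
      (NCOT.weak_duality hε hH hΓ.1 hU.1))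
    rw [← NCOT.primalFun_gibbs hε hH hU.1 (hmin hU).1]
    exact hΓ.2 (hmin hU).1
  refine ⟨?_, ⟨U₀, hU₀⟩, fun U U' hU hU' => ?_, ⟨_, hmin hU₀, fun Γ hΓ => hgibbs hU₀ hΓ⟩,
    fun U Γ hU hΓ => hgibbs hU hΓ⟩
  · have h1 : IsLeast (NCOT.primalFun ε H m '' NCOT.couplings γ)
        (NCOT.primalFun ε H m (NCOT.gibbs ε H m U₀)) :=
      ⟨Set.mem_image_of_mem _ (hmin hU₀).1, by
        rintro _ ⟨Γ, hΓ, rfl⟩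
        exact (hmin hU₀).2 hΓ⟩
    have h2 : IsGreatest (NCOT.dualFun ε H m γ '' NCOT.potentials fun i => Fin (d i))
        (NCOT.dualFun ε H m γ U₀) :=
      ⟨Set.mem_image_of_mem _ hU₀.1, by
        rintro _ ⟨U, hU, rfl⟩
        exact hU₀.2 hU⟩
    rw [NCOT.primalValue, NCOT.dualValue, h1.csInf_eq, h2.csSup_eq,
      NCOT.primalFun_gibbs hε hH hU₀.1 (hmin hU₀).1]
  -- The Gibbs operator of `U` is a primal minimiser, hence equals that of `U'`; the exponents, and
  -- then the Kronecker sums, agree.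
  · have h := NCOT.exp_injective_of_isHermitian
      (NCOT.gibbs_exponent_isHermitian hH hU.1) (NCOT.gibbs_exponent_isHermitian hH hU'.1)
      (hgibbs hU' (hmin hU))
    have h' := sub_left_injective (smul_right_injective _ (inv_ne_zero hε.ne') h)
    refine NCOT.exists_smul_one_of_kroneckerSum_eq_zero (U := U' - U)
      (fun i => (hU'.1 i).sub (hU.1 i)) ?_
    have hs : NCOT.kroneckerSum (U' - U) = NCOT.kroneckerSum U' - NCOT.kroneckerSum U :=
      (NCOT.kroneckerSumLin _).map_sub U' U
    rw [hs, sub_eq_zero]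
    exact h'.symm
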